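/- Let $K$ be a field, $n,d\in\mathbb{N}$, and let $\mathbb{T}^n$ be the set of terms (monomials with coefficient $1$) of $K[x_1,\dots,x_n]$. Write $\mathbb{T}^n_{=i}$, $\mathbb{T}^n_{\le i}$ for the terms of total degree $i$, resp. at most $i$, and put $L=\mathbb{T}^n_{\le d}$, $L^{=i}=\mathbb{T}^n_{=i}$ for $i\le d$. For a set $S$ of polynomials let $\langle S\rangle_K$ be its $K$-linear span and $(S)$ the ideal it generates. For a $K$-subspace $V$ of $K[x_1,\dots,x_n]$ let $V^{\le i}=\{p\in V: \deg p\le i\}$ ($V^{\le -1}=0$); the quotient $V^{\le i}/V^{\le i-1}$ is regarded as a subspace of $\langle\mathbb{T}^n_{=i}\rangle_K$ by taking homogeneous components of degree $i$. For an ideal $I$ with $\dim_K K[x_1,\dots,x_n]/I<\infty$, the order ideal polytope $P(I)\subseteq\mathbb{R}^{\mathbb{T}^n}$ is the set of all $z$ such that * $z_{m_1}\ge z_{m_2}$ for all $m_1,m_2\in\mathbb{T}^n$ with $m_1\mid m_2$; * $\sum_{m\in\mathbb{T}^n_{=i}}z_m=\dim\langle\mathbb{T}^n_{=i}\rangle_K-\dim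 I^{\le i}/I^{\le i-1}$ for all $i\ge 0$; * $\sum_{m\in U}z_m\le\dim\langle U\cup I^{\le i}/I^{\le i-1}\rangle_K-\dim I^{\le i}/I^{\le i-1}$ for all $i\ge0$ and all $U\subseteq\mathbb{T}^n_{=i}$ with $|U|=\dim\langle\mathbb{T}^n_{=i}\rangle_K-\dim I^{\le i}/I^{\le i-1}$; * $z_m\in[0,1]$ for all $m\in\mathbb{T}^n$. Let $M$ be a finite set of polynomials such that $K[x_1,\dots,x_n]/(M)$ is finite dimensional over $K$. Assume: * $M$ is $L$-stabilized, i.e. $\operatorname{supp}(p)\subseteq L$ for all $p\in M$, and $\langle M^+\rangle_K\cap\langle L\rangle_K=\langle M\rangle_K$, where $M^+=M\cup Mx_1\cup\dots\cup Mx_n$; * $M$ is in canonical form, i.e. one can choose for each $p\in M$ a leading term, meaning a term of maximal degree in $\operatorname{supp}(p)$, which does not occur in any other element of $M$; * $\langle M\rangle_K^{\le d}/\langle M\rangle_K^{\le d-1}\cong\langle\mathbb{T}^n_{=d}\rangle_K$ as $K$-vector spaces. Let $M_i=\{p\in M:\deg p=i\}$, and let $\operatorname{LF}(M_i)$ be the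 set of leading forms (homogeneous parts of top degree) of the elements of $M_i$. For $U\subseteq L^{=i}$ let $\tilde U$ be the coefficient matrix of $\operatorname{LF}(M_i)$ (rows: the elements; columns: terms) restricted to the columns in $U$. Let $P(M,L)\subseteq[0,1]^L$ be the set of all $z\in\mathbb{R}^L$ such that * $z_{m_1}\ge z_{m_2}$ for all $m_1,m_2\in L$ with $m_1\mid m_2$; * $\sum_{m\in L^{=i}}z_m=\dim\langle L^{=i}\rangle_K-\dim\langle\operatorname{LF}(M_i)\rangle_K$ for all $0\le i\le d-1$; * $\sum_{m\in U}z_m\ge|U|-\operatorname{rk}\tilde U$ for all $0\le i\le d-1$ and all $U\subseteq L^{=i}$ with $|U|=\dim\langle\operatorname{LF}(M_i)\rangle_K$; * $z_m=0$ for all $m\in L^{=d}$; * $z_m\in[0,1]$ for all $m\in L$. Then $P((M))$, the order ideal polytope of the ideal generated by $M$, equals $P(M,L)$, where $\mathbb{R}^L$ is regarded as the subspace of $\mathbb{R}^{\mathbb{T}^n}$ of vectors vanishing outside $L$. -/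

import Mathlib

open MvPolynomial

/-! Terms `x^m` in `n` indeterminates are represented by their exponent vectors
`m : Fin n →₀ ℕ`; the total degree of `x^m` is `m.degree`, and `x^m ∣ x^m'` is `m ≤ m'`.
The vector space spanned by a set `S` of terms is `MvPolynomial.restrictSupport K S`. -/

namespace OrderIdealPolytope

noncomputable section

/-- The set of terms of total degree exactly `i`. -/
def termsEq (n i : ℕ) : Finset (Fin n →₀ ℕ) :=
  (Finsupp.finite_of_degree_eq (σ := Fin n) i).toFinset

/-- The set of terms of total degree at most `d`. -/
def termsLE (n d : ℕ) : Finset (Fin n →₀ ℕ) :=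
  (Finsupp.finite_of_degree_le (σ := Fin n) d).toFinset

@[simp] lemma mem_termsEq {n i : ℕ} {m : Fin n →₀ ℕ} : m ∈ termsEq n i ↔ m.degree = i := by
  simp [termsEq]

@[simp] lemma mem_termsLE {n d : ℕ} {m : Fin n →₀ ℕ} : m ∈ termsLE n d ↔ m.degree ≤ d := by
  simp [termsLE]

variable {K : Type*} [Field K] {n : ℕ}

/-! ### Degree filtration -/

/-- `V^{≤ i}`: the elements of `V` of degree at most `i`. -/
def degLE (V : Submodule K (MvPolynomial (Fin n) K)) (i : ℕ) :
    Submodule K (MvPolynomial (Fin n) K) :=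
  V ⊓ restrictSupport K {m | m.degree ≤ i}

/-- `V^{≤ i-1}`: the elements of `V` all of whose terms have degree `< i`
(this is `0` for `i = 0`). -/
def degLT (V : Submodule K (MvPolynomial (Fin n) K)) (i : ℕ) :
    Submodule K (MvPolynomial (Fin n) K) :=
  V ⊓ restrictSupport K {m | m.degree < i}

/-- The graded piece `V^{≤ i} / V^{≤ i-1}`. -/
abbrev GradedPiece (V : Submodule K (MvPolynomial (Fin n) K)) (i : ℕ) : Type _ :=
  ↥(degLE V i) ⧸ (degLT V i).submoduleOf (degLE V i)

/-- The copy of `V^{≤ i} / V^{≤ i-1}` inside the span of the terms of degree `i`: the space of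
degree `i` homogeneous components of elements of `V^{≤ i}`. -/
def topForms (V : Submodule K (MvPolynomial (Fin n) K)) (i : ℕ) :
    Submodule K (MvPolynomial (Fin n) K) :=
  (degLE V i).map (homogeneousComponent i)

lemma ker_homogeneousComponent_domRestrict (V : Submodule K (MvPolynomial (Fin n) K)) (i : ℕ) :
    LinearMap.ker ((homogeneousComponent (R := K) i).domRestrict (degLE V i)) =
      (degLT V i).submoduleOf (degLE V i) := by
  ext ⟨p, hp⟩
  have hV := hp.1
  have hp2 : ∀ m ∈ p.support, m.degree ≤ i := fun m hm => hp.2 hm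
  rw [LinearMap.mem_ker, LinearMap.domRestrict_apply, Submodule.submoduleOf,
    Submodule.mem_comap, Submodule.subtype_apply, degLT, Submodule.mem_inf]
  constructor
  · intro h
    refine ⟨hV, fun m hm => lt_of_le_of_ne (hp2 m hm) fun hmi => ?_⟩
    have h' := congrArg (coeff m) h
    rw [coeff_homogeneousComponent, if_pos hmi, coeff_zero] at h'
    exact (mem_support_iff.mp hm) h'
  · rintro ⟨-, h⟩
    ext m
    rw [coeff_homogeneousComponent, coeff_zero]
    split_ifs with hmi
    · by_contra hne
      have hlt : m.degree < i := h (mem_support_iff.mpr hne)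
      exact absurd hmi hlt.ne
    · rfl

/-- The degree `i` component identifies `V^{≤ i} / V^{≤ i-1}` with `topForms V i`. -/
def gradedPieceEquiv (V : Submodule K (MvPolynomial (Fin n) K)) (i : ℕ) :
    GradedPiece V i ≃ₗ[K] topForms V i :=
  (Submodule.quotEquivOfEq _ _ (ker_homogeneousComponent_domRestrict V i).symm).trans <|
    (LinearMap.quotKerEquivRange _).trans <|
      LinearEquiv.ofEq _ _ (by rw [LinearMap.range_domRestrict, topForms])

/-! ### The order ideal polytope of an ideal -/

/-- The order ideal polytope `P(I)` of an ideal `I`, in the space of real vectors indexed by all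
terms. -/
def orderIdealPolytope (I : Ideal (MvPolynomial (Fin n) K)) : Set ((Fin n →₀ ℕ) → ℝ) :=
  {z |
    (∀ m₁ m₂ : Fin n →₀ ℕ, m₁ ≤ m₂ → z m₁ ≥ z m₂) ∧
    (∀ i : ℕ, ∑ m ∈ termsEq n i, z m =
      (Module.finrank K (restrictSupport K (termsEq n i : Set (Fin n →₀ ℕ))) : ℝ) -
        Module.finrank K (GradedPiece (I.restrictScalars K) i)) ∧
    (∀ (i : ℕ) (U : Finset (Fin n →₀ ℕ)), U ⊆ termsEq n i →
      (U.card : ℤ) =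
        (Module.finrank K (restrictSupport K (termsEq n i : Set (Fin n →₀ ℕ))) : ℤ) -
          Module.finrank K (GradedPiece (I.restrictScalars K) i) →
      ∑ m ∈ U, z m ≤
        (Module.finrank K
          ↥(restrictSupport K (U : Set (Fin n →₀ ℕ)) ⊔ topForms (I.restrictScalars K) i) : ℝ) -
          Module.finrank K (GradedPiece (I.restrictScalars K) i)) ∧
    (∀ m, z m ∈ Set.Icc (0 : ℝ) 1)}

/-! ### Stabilized sets, canonical form, and the explicit polytope -/

/-- The neighborhood extension `W⁺ = W ∪ W x₁ ∪ ⋯ ∪ W xₙ`. -/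
def neighborhoodExt (W : Set (MvPolynomial (Fin n) K)) : Set (MvPolynomial (Fin n) K) :=
  W ∪ ⋃ j : Fin n, (fun p => p * X j) '' W

/-- `M` is `L`-stabilized: `supp M ⊆ L` and `⟨M⁺⟩ ∩ ⟨L⟩ = ⟨M⟩`. -/
def IsStabilized (L : Finset (Fin n →₀ ℕ)) (M : Finset (MvPolynomial (Fin n) K)) : Prop :=
  (∀ p ∈ M, p.support ⊆ L) ∧
    Submodule.span K (neighborhoodExt (M : Set (MvPolynomial (Fin n) K))) ⊓
      restrictSupport K (L : Set (Fin n →₀ ℕ)) =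
    Submodule.span K (M : Set (MvPolynomial (Fin n) K))

/-- `M` is in canonical form: one can choose for each element of `M` a leading term, i.e. a term of
maximal degree in its support, that occurs in no other element of `M`. -/
def IsCanonicalForm (M : Finset (MvPolynomial (Fin n) K)) : Prop :=
  ∃ lt : MvPolynomial (Fin n) K → (Fin n →₀ ℕ), ∀ p ∈ M,
    lt p ∈ p.support ∧ (∀ m ∈ p.support, m.degree ≤ (lt p).degree) ∧
      ∀ q ∈ M, q ≠ p → lt p ∉ q.support

/-- The leading form of `p`: its homogeneous part of maximal degree. -/
def leadingForm (p : MvPolynomial (Fin n) K) : MvPolynomial (Fin n) K :=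
  homogeneousComponent p.totalDegree p

/-- `M_i`: the elements of `M` of degree `i`. -/
def degPart (M : Finset (MvPolynomial (Fin n) K)) (i : ℕ) : Finset (MvPolynomial (Fin n) K) :=
  M.filter fun p => p.totalDegree = i

/-- The span of the leading forms `LF(M_i)`. -/
def leadingFormSpan (M : Finset (MvPolynomial (Fin n) K)) (i : ℕ) :
    Submodule K (MvPolynomial (Fin n) K) :=
  Submodule.span K (leadingForm '' (degPart M i : Set (MvPolynomial (Fin n) K)))

/-- The coefficient matrix of `LF(M_i)`, with rows indexed by the elements of `M_i`, restricted to
the columns in `U`. -/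
def leadingFormMatrix (M : Finset (MvPolynomial (Fin n) K)) (i : ℕ) {L : Finset (Fin n →₀ ℕ)}
    (U : Finset L) : Matrix (degPart M i) U K :=
  Matrix.of fun p m => coeff ((m : L) : Fin n →₀ ℕ) (leadingForm (p : MvPolynomial (Fin n) K))

/-- For `L` the set of terms of degree at most `d`: the set `L^{=i}`, as a set of elements
of `L`. -/
def universeEq (n d i : ℕ) : Finset (termsLE n d) :=
  Finset.univ.filter fun m => (m : Fin n →₀ ℕ).degree = i

/-- The explicit polytope `P(M, L) ⊆ [0,1]^L` for `L` the set of terms of degree at most `d`. -/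
def explicitPolytope (d : ℕ) (M : Finset (MvPolynomial (Fin n) K)) : Set (termsLE n d → ℝ) :=
  {z |
    (∀ m₁ m₂ : termsLE n d, (m₁ : Fin n →₀ ℕ) ≤ m₂ → z m₁ ≥ z m₂) ∧
    (∀ i < d, ∑ m ∈ universeEq n d i, z m =
      (Module.finrank K (restrictSupport K (termsEq n i : Set (Fin n →₀ ℕ))) : ℝ) -
        Module.finrank K (leadingFormSpan M i)) ∧
    (∀ i < d, ∀ U : Finset (termsLE n d), U ⊆ universeEq n d i →
      U.card = Module.finrank K (leadingFormSpan M i) →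
      ∑ m ∈ U, z m ≥ (U.card : ℝ) - (leadingFormMatrix M i U).rank) ∧
    (∀ m ∈ universeEq n d d, z m = 0) ∧
    (∀ m, z m ∈ Set.Icc (0 : ℝ) 1)}

/-- Extension by zero of a vector indexed by a finite set `L` of terms to all terms; this realizes
`ℝ^L` as a coordinate subspace of the space of vectors indexed by all terms. -/
def extendByZero {L : Finset (Fin n →₀ ℕ)} (z : L → ℝ) : (Fin n →₀ ℕ) → ℝ :=
  fun m => if h : m ∈ L then z ⟨m, h⟩ else 0

end

end OrderIdealPolytope

/-! Let `W` be the span of `M` and `I` the ideal generated by `M`. Both polytopes depend on their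
data only through spaces of leading forms, so the point is to compute those of `I`. From degree `d`
on they are everything: this holds for `W` in degree `d`, and multiplying by indeterminates
propagates it upwards. In degrees up to `d` one needs that `I` has no elements of degree at most `d`
beyond `W`; canonical form then rules out cancellation of leading terms, so that the leading forms
of `W` are spanned by those of `M` (`topForms_span_eq_leadingFormSpan`).

The equality of `I` and `W` up to degree `d` is `mem_of_mem_ideal_span_of_stabilized`, a border
basis argument. Reduction modulo `W` brings every polynomial of degree at most `d` below degree `d`.
Stabilization makes the operators "multiply by an indeterminate, then reduce" commute, so they
define an action of the polynomial ring. Acting on the normal form of `1` computes normal forms up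
to degree `d`, while the annihilator of that vector is an ideal containing `W`, hence `I`. Elements
of `I` of degree at most `d` thus have normal form `0` and lie in `W`.

What remains is linear algebra: in each degree below `d`, rank-nullity matches the inequality for a
set of terms with the one for its complement (`forall_sum_le_iff_forall_sum_ge`). -/

namespace OrderIdealPolytope

variable {K : Type*} [Field K] {n : ℕ}

/-! ### Normal forms modulo a stabilized space -/

/-- If every element of `B` is congruent modulo `W` to an element of `A`, then such representatives
can be chosen linearly and depending only on the class modulo `W`. -/
lemma exists_linear_normalForm {V : Type*} [AddCommGroup V] [Module K V] {W A B : Submodule K V}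
    (hAB : ∀ f ∈ B, ∃ a ∈ A, f - a ∈ W) :
    ∃ σ : V →ₗ[K] V, (∀ w ∈ W, σ w = 0) ∧ (∀ f, σ f ∈ A) ∧ ∀ f ∈ B, f - σ f ∈ W := by
  -- A linear section `s` of `A → V ⧸ W` exists on the image, which contains the classes of `B`. Its
  -- extension `t` to the whole quotient is arbitrary elsewhere.
  set π : A →ₗ[K] V ⧸ W := W.mkQ.domRestrict A with hπ
  obtain ⟨s, hs⟩ := π.rangeRestrict.exists_rightInverse_of_surjective π.range_rangeRestrict
  obtain ⟨t, ht⟩ := s.exists_extend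
  refine ⟨A.subtype ∘ₗ t ∘ₗ W.mkQ, fun w hw => ?_, fun f => (t (W.mkQ f)).2, fun f hf => ?_⟩
  · have : W.mkQ w = 0 := by simpa using hw
    simp only [LinearMap.comp_apply, this, map_zero]
  · obtain ⟨a, ha, hfa⟩ := hAB f hf
    have hq : W.mkQ f = W.mkQ a := (Submodule.Quotient.eq W).2 hfa
    have hr : W.mkQ f ∈ LinearMap.range π := ⟨⟨a, ha⟩, hq.symm⟩
    have h1 : t (W.mkQ f) = s ⟨W.mkQ f, hr⟩ := LinearMap.congr_fun ht ⟨W.mkQ f, hr⟩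
    have h2 := congrArg Subtype.val (LinearMap.congr_fun hs ⟨W.mkQ f, hr⟩)
    refine (Submodule.Quotient.eq W).1 ?_
    change W.mkQ f = W.mkQ ((t (W.mkQ f) : A) : V)
    rw [h1]
    exact h2.symm

open scoped IsMulCommutative in
/-- Pairwise commuting endomorphisms turn into a linear action of the polynomial ring. -/
lemma exists_algHom_end_of_commute {V : Type*} [AddCommGroup V] [Module K V]
    (Y : Fin n → Module.End K V) (hY : ∀ i j, Y i * Y j = Y j * Y i) :
    ∃ Φ : MvPolynomial (Fin n) K →ₐ[K] Module.End K V, ∀ j, Φ (X j) = Y j := by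
  have hc : ∀ a ∈ Set.range Y, ∀ b ∈ Set.range Y, a * b = b * a := by
    rintro _ ⟨i, rfl⟩ _ ⟨j, rfl⟩
    exact hY i j
  -- `aeval` needs a commutative target, hence the detour through the subalgebra generated by the
  -- operators.
  have := Algebra.isMulCommutative_adjoin K hc
  refine ⟨(Algebra.adjoin K (Set.range Y)).val.comp
    (aeval fun j => (⟨Y j, Algebra.subset_adjoin ⟨j, rfl⟩⟩ : Algebra.adjoin K (Set.range Y))),
    fun j => ?_⟩
  simp

lemma X_mul_mem_restrictSupport_degree_le {d : ℕ} {f : MvPolynomial (Fin n) K}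
    (hf : f ∈ restrictSupport K {m : Fin n →₀ ℕ | m.degree < d}) (j : Fin n) :
    X j * f ∈ restrictSupport K {m : Fin n →₀ ℕ | m.degree ≤ d} := by
  rw [mem_restrictSupport_iff] at hf ⊢
  intro m hm
  rw [Finset.mem_coe, support_X_mul, Finset.mem_map] at hm
  obtain ⟨m', hm', rfl⟩ := hm
  have := hf hm'
  simp only [Set.mem_ofPred_eq, addLeftEmbedding_apply, map_add, Finsupp.degree_single] at this ⊢
  omega

/-- A space of polynomials of degree at most `d` that is stable under multiplication by
indeterminates as long as the degree does not exceed `d`, and that contains polynomials with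
arbitrary leading forms of degree `d`, contains all elements of degree at most `d` of the ideal
it generates. -/
lemma mem_of_mem_ideal_span_of_stabilized {d : ℕ} {W W' : Submodule K (MvPolynomial (Fin n) K)}
    (hX : ∀ w ∈ W, ∀ j, X j * w ∈ W')
    (hst : W' ⊓ restrictSupport K {m : Fin n →₀ ℕ | m.degree ≤ d} = W)
    (hred : ∀ f ∈ restrictSupport K {m : Fin n →₀ ℕ | m.degree ≤ d},
      ∃ a ∈ restrictSupport K {m : Fin n →₀ ℕ | m.degree < d}, f - a ∈ W)
    {f : MvPolynomial (Fin n) K} (hf : f ∈ Ideal.span (W : Set (MvPolynomial (Fin n) K)))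
    (hfd : f ∈ restrictSupport K {m : Fin n →₀ ℕ | m.degree ≤ d}) : f ∈ W := by
  set B := restrictSupport K {m : Fin n →₀ ℕ | m.degree ≤ d}
  set A := restrictSupport K {m : Fin n →₀ ℕ | m.degree < d}
  have hWB : W ≤ B := hst ▸ inf_le_right
  have hAB : A ≤ B := restrictSupport_mono K fun m (hm : m.degree < d) => hm.le
  have hXA : ∀ a ∈ A, ∀ j, X j * a ∈ B := fun a ha j => X_mul_mem_restrictSupport_degree_le ha j
  obtain ⟨σ, hσW, hσA, hσB⟩ := exists_linear_normalForm hred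
  have hcongr : ∀ f g, f - g ∈ W → σ f = σ g := fun f g h => by
    rw [← sub_eq_zero, ← map_sub, hσW _ h]
  have hidem : ∀ f ∈ B, σ (σ f) = σ f := fun f hf => (hcongr _ _ (hσB f hf)).symm
  have hXW : ∀ w ∈ W, w ∈ A → ∀ j, X j * w ∈ W := fun w hw hwA j =>
    hst.le ⟨hX w hw j, hXA w hwA j⟩
  -- The inner `σ` makes the input have degree below `d`, so the product stays in `B`, where `σ` is
  -- a genuine reduction.
  let Y : Fin n → Module.End K (MvPolynomial (Fin n) K) := fun j =>
    σ ∘ₗ LinearMap.mulLeft K (X j) ∘ₗ σ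
  have hYapp : ∀ j f, Y j f = σ (X j * σ f) := fun j f => rfl
  have hY : ∀ i j, Y i * Y j = Y j * Y i := by
    intro i j
    refine LinearMap.ext fun f => ?_
    have hB : ∀ k, X k * σ f ∈ B := fun k => hXA _ (hσA f) k
    simp only [Module.End.mul_apply, hYapp, hidem _ (hB _)]
    refine hcongr _ _ (hst.le ⟨?_, sub_mem (hXA _ (hσA _) i) (hXA _ (hσA _) j)⟩)
    -- The S-polynomial step: the difference is a combination of multiples `X k * w` with `w ∈ W`,
    -- hence in `W'`. Its degree is at most `d`, so stabilization puts it back in `W`.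
    have : X i * σ (X j * σ f) - X j * σ (X i * σ f) =
        X j * (X i * σ f - σ (X i * σ f)) - X i * (X j * σ f - σ (X j * σ f)) := by ring
    rw [this]
    exact sub_mem (hX _ (hσB _ (hB i)) j) (hX _ (hσB _ (hB j)) i)
  obtain ⟨Φ, hΦ⟩ := exists_algHom_end_of_commute Y hY
  have hmon : ∀ m : Fin n →₀ ℕ, m.degree ≤ d →
      Φ (monomial m 1) (σ 1) = σ (monomial m 1) := by
    intro m
    induction hk : m.degree generalizing m with
    | zero =>
      intro _
      rw [(Finsupp.degree_eq_zero_iff m).1 hk, monomial_zero', map_one, map_one,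
        Module.End.one_apply]
    | succ k ih =>
      intro hkd
      have hm : m ≠ 0 := fun h => by simp [h] at hk
      obtain ⟨j, hj⟩ := Finsupp.ne_iff.1 hm
      obtain ⟨m', rfl⟩ : ∃ m', m = Finsupp.single j 1 + m' := by
        refine exists_add_of_le (Finsupp.single_le_iff.2 ?_)
        exact Nat.one_le_iff_ne_zero.2 hj
      have hk' : m'.degree = k := by
        rw [map_add, Finsupp.degree_single] at hk
        omega
      have hA : monomial m' (1 : K) ∈ A := (monomial_mem_restrictSupport K).2
        (Or.inl (show m'.degree < d by omega))
      rw [monomial_single_add, pow_one, map_mul, hΦ, Module.End.mul_apply, ih m' hk' (by omega),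
        hYapp, hidem _ (hAB hA)]
      refine hcongr _ _ ?_
      -- The reduction error of `m'` lies in `W` and has degree below `d`, so its multiple by `X j`
      -- is still in `W`.
      rw [← mul_sub]
      refine hXW _ ?_ (sub_mem (hσA _) hA) j
      rw [← neg_sub]
      exact neg_mem (hσB _ (hAB hA))
  have hΦB : ∀ f ∈ B, Φ f (σ 1) = σ f := by
    intro f hf
    rw [f.as_sum, map_sum, map_sum, LinearMap.sum_apply]
    refine Finset.sum_congr rfl fun m hm => ?_
    have : monomial m (coeff m f) = coeff m f • monomial m (1 : K) := by simp [smul_monomial]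
    rw [this, map_smul, map_smul, LinearMap.smul_apply, hmon m (hf hm)]
  have hker : ∀ f ∈ Ideal.span (W : Set (MvPolynomial (Fin n) K)), Φ f (σ 1) = 0 := by
    intro f hf
    induction hf using Submodule.span_induction with
    | mem w hw => rw [hΦB w (hWB hw), hσW w hw]
    | zero => simp
    | add f g _ _ hf hg => rw [map_add, LinearMap.add_apply, hf, hg, add_zero]
    | smul p f _ hf => rw [smul_eq_mul, map_mul, Module.End.mul_apply, hf, map_zero]
  have h0 : σ f = 0 := by rw [← hΦB f hfd, hker f hf]
  simpa [h0] using hσB f hfd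

lemma mem_restrictSupport_iff_coeff {S : Set (Fin n →₀ ℕ)} {p : MvPolynomial (Fin n) K} :
    p ∈ restrictSupport K S ↔ ∀ m, coeff m p ≠ 0 → m ∈ S := by
  rw [mem_restrictSupport_iff]
  exact ⟨fun h m hm => h (mem_support_iff.2 hm), fun h m hm => h m (mem_support_iff.1 hm)⟩

lemma homogeneousComponent_X_mul (i : ℕ) (j : Fin n) (f : MvPolynomial (Fin n) K) :
    homogeneousComponent (i + 1) (X j * f) = X j * homogeneousComponent i f := by
  ext m
  rw [coeff_homogeneousComponent, coeff_X_mul', coeff_X_mul']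
  by_cases hj : j ∈ m.support
  · have hle : Finsupp.single j 1 ≤ m :=
      Finsupp.single_le_iff.2 (Nat.one_le_iff_ne_zero.2 (Finsupp.mem_support_iff.1 hj))
    obtain ⟨m', rfl⟩ := exists_add_of_le hle
    simp only [hj, if_true, add_tsub_cancel_left, coeff_homogeneousComponent, map_add,
      Finsupp.degree_single, add_comm 1, Nat.add_right_cancel_iff]
  · simp [hj]

/-! ### Dimensions of coordinate subspaces -/

lemma finrank_restrictSupport (U : Finset (Fin n →₀ ℕ)) :
    Module.finrank K (restrictSupport K (U : Set (Fin n →₀ ℕ))) = U.card := by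
  rw [Module.finrank_eq_card_basis (basisRestrictSupport K (U : Set (Fin n →₀ ℕ)))]
  simp

instance (U : Finset (Fin n →₀ ℕ)) :
    FiniteDimensional K (restrictSupport K (U : Set (Fin n →₀ ℕ))) :=
  (basisRestrictSupport K (U : Set (Fin n →₀ ℕ))).finiteDimensional_of_finite

lemma finrank_restrictSupport_sup_add_finrank_inf (U : Finset (Fin n →₀ ℕ))
    (V : Submodule K (MvPolynomial (Fin n) K)) [FiniteDimensional K V] :
    Module.finrank K ↥(restrictSupport K (U : Set (Fin n →₀ ℕ)) ⊔ V) +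
      Module.finrank K ↥(restrictSupport K (U : Set (Fin n →₀ ℕ)) ⊓ V) =
    U.card + Module.finrank K V := by
  rw [Submodule.finrank_sup_add_finrank_inf_eq, finrank_restrictSupport]

/-- Rank-nullity for a restricted map. For `coeffs U`, the kernel part consists of the elements of
`V` with no term in `U`. -/
lemma finrank_map_add_finrank_ker_inf {V₁ V₂ : Type*} [AddCommGroup V₁] [Module K V₁]
    [AddCommGroup V₂] [Module K V₂] (π : V₁ →ₗ[K] V₂) (V : Submodule K V₁)
    [FiniteDimensional K V] :
    Module.finrank K (V.map π) + Module.finrank K ↥(LinearMap.ker π ⊓ V) =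
      Module.finrank K V := by
  rw [← LinearMap.finrank_range_add_finrank_ker (π.domRestrict V), LinearMap.range_domRestrict]
  congr 1
  rw [inf_comm, ← Submodule.map_comap_subtype, Submodule.finrank_map_subtype_eq]
  rfl

/-- The linear map reading off the coefficients of the terms in `U`. -/
noncomputable def coeffs {L : Finset (Fin n →₀ ℕ)} (U : Finset L) :
    MvPolynomial (Fin n) K →ₗ[K] U → K :=
  LinearMap.pi fun m => lcoeff K ((m : L) : Fin n →₀ ℕ)

lemma coeffs_apply {L : Finset (Fin n →₀ ℕ)} (U : Finset L) (p : MvPolynomial (Fin n) K) (m : U) :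
    coeffs U p m = coeff ((m : L) : Fin n →₀ ℕ) p := rfl

lemma rank_leadingFormMatrix (M : Finset (MvPolynomial (Fin n) K)) (i : ℕ)
    {L : Finset (Fin n →₀ ℕ)} (U : Finset L) :
    (leadingFormMatrix M i U).rank = Module.finrank K ((leadingFormSpan M i).map (coeffs U)) := by
  rw [Matrix.rank_eq_finrank_span_row, leadingFormSpan, Submodule.map_span]
  suffices h : Set.range (leadingFormMatrix M i U).row =
      coeffs U '' (leadingForm '' (degPart M i : Set (MvPolynomial (Fin n) K))) by rw [h]
  ext v
  simp only [Set.mem_range, Set.mem_image, Subtype.exists, Finset.mem_coe]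
  constructor
  · rintro ⟨p, hp, rfl⟩
    exact ⟨_, ⟨p, hp, rfl⟩, rfl⟩
  · rintro ⟨_, ⟨p, hp, rfl⟩, rfl⟩
    exact ⟨p, hp, rfl⟩

lemma ker_coeffs_inf {L : Finset (Fin n →₀ ℕ)} (U : Finset L) {T S : Finset (Fin n →₀ ℕ)}
    (hS : ∀ m, m ∈ S ↔ m ∈ T ∧ ∀ u ∈ U, (u : Fin n →₀ ℕ) ≠ m)
    {V : Submodule K (MvPolynomial (Fin n) K)}
    (hV : V ≤ restrictSupport K (T : Set (Fin n →₀ ℕ))) :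
    LinearMap.ker (coeffs U) ⊓ V = restrictSupport K (S : Set (Fin n →₀ ℕ)) ⊓ V := by
  ext p
  simp only [Submodule.mem_inf, LinearMap.mem_ker, and_congr_left_iff]
  intro hp
  constructor
  · intro h m hm
    refine (hS m).2 ⟨hV hp hm, fun u hu hum => ?_⟩
    have := congrFun h ⟨u, hu⟩
    rw [coeffs_apply] at this
    exact mem_support_iff.1 hm (hum ▸ this)
  · intro h
    funext u
    rw [coeffs_apply]
    by_contra hne
    exact ((hS _).1 (h (mem_support_iff.2 hne))).2 u u.2 rfl

/-- Complementary column sets: the corank of the matrix on the columns `U` is the dimension of the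
intersection of the row space with the span of the remaining terms. -/
lemma rank_leadingFormMatrix_add_finrank_sup (M : Finset (MvPolynomial (Fin n) K)) (i : ℕ)
    {L : Finset (Fin n →₀ ℕ)} (U : Finset L) {T S : Finset (Fin n →₀ ℕ)}
    (hS : ∀ m, m ∈ S ↔ m ∈ T ∧ ∀ u ∈ U, (u : Fin n →₀ ℕ) ≠ m)
    (hV : leadingFormSpan M i ≤ restrictSupport K (T : Set (Fin n →₀ ℕ))) :
    Module.finrank K ↥(restrictSupport K (S : Set (Fin n →₀ ℕ)) ⊔ leadingFormSpan M i) =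
      S.card + (leadingFormMatrix M i U).rank := by
  have : FiniteDimensional K (leadingFormSpan M i) := Submodule.finiteDimensional_of_le hV
  have h1 := finrank_restrictSupport_sup_add_finrank_inf S (leadingFormSpan M i)
  have h2 := finrank_map_add_finrank_ker_inf (coeffs U) (leadingFormSpan M i)
  rw [ker_coeffs_inf U hS hV, ← rank_leadingFormMatrix] at h2
  omega

/-! ### Leading forms -/

lemma mem_topForms {V : Submodule K (MvPolynomial (Fin n) K)} {i : ℕ}
    {p : MvPolynomial (Fin n) K} :
    p ∈ topForms V i ↔ ∃ f ∈ V, f ∈ restrictSupport K {m : Fin n →₀ ℕ | m.degree ≤ i} ∧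
      homogeneousComponent i f = p := by
  simp only [topForms, degLE, Submodule.mem_map, Submodule.mem_inf, and_assoc]

lemma homogeneousComponent_mem_restrictSupport (i : ℕ) (f : MvPolynomial (Fin n) K) :
    homogeneousComponent i f ∈ restrictSupport K (termsEq n i : Set (Fin n →₀ ℕ)) := by
  refine mem_restrictSupport_iff_coeff.2 fun m hm => ?_
  rw [coeff_homogeneousComponent] at hm
  exact mem_termsEq.2 (by_contra fun h => hm (if_neg h))

lemma topForms_le (V : Submodule K (MvPolynomial (Fin n) K)) (i : ℕ) :
    topForms V i ≤ restrictSupport K (termsEq n i : Set (Fin n →₀ ℕ)) := by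
  rintro p hp
  obtain ⟨f, -, -, rfl⟩ := mem_topForms.1 hp
  exact homogeneousComponent_mem_restrictSupport i f

lemma topForms_mono {V W : Submodule K (MvPolynomial (Fin n) K)} (h : V ≤ W) (i : ℕ) :
    topForms V i ≤ topForms W i :=
  Submodule.map_mono (inf_le_inf_right _ h)

lemma finrank_gradedPiece (V : Submodule K (MvPolynomial (Fin n) K)) (i : ℕ) :
    Module.finrank K (GradedPiece V i) = Module.finrank K (topForms V i) :=
  (gradedPieceEquiv V i).finrank_eq

lemma topForms_eq_of_gradedPiece_equiv {V : Submodule K (MvPolynomial (Fin n) K)} {d : ℕ}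
    (h : Nonempty (GradedPiece V d ≃ₗ[K] restrictSupport K (termsEq n d : Set (Fin n →₀ ℕ)))) :
    topForms V d = restrictSupport K (termsEq n d : Set (Fin n →₀ ℕ)) := by
  obtain ⟨e⟩ := h
  exact Submodule.eq_of_le_of_finrank_eq (topForms_le V d)
    (by rw [← finrank_gradedPiece, e.finrank_eq])

/-- If all forms of degree `d` are leading forms of elements of `V`, every polynomial of degree at
most `d` is congruent modulo `V` to a polynomial of smaller degree. -/
lemma exists_sub_mem_of_topForms_eq {V : Submodule K (MvPolynomial (Fin n) K)} {d : ℕ}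
    (h : topForms V d = restrictSupport K (termsEq n d : Set (Fin n →₀ ℕ)))
    {f : MvPolynomial (Fin n) K}
    (hf : f ∈ restrictSupport K {m : Fin n →₀ ℕ | m.degree ≤ d}) :
    ∃ a ∈ restrictSupport K {m : Fin n →₀ ℕ | m.degree < d}, f - a ∈ V := by
  obtain ⟨w, hw, hwd, hwf⟩ := mem_topForms.1
    (h.ge (homogeneousComponent_mem_restrictSupport d f))
  refine ⟨f - w, mem_restrictSupport_iff_coeff.2 fun m hm => ?_, by simpa using hw⟩
  have hle : m.degree ≤ d := mem_restrictSupport_iff_coeff.1 (sub_mem hf hwd) m hm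
  refine lt_of_le_of_ne hle fun hmd => hm ?_
  have := congrArg (coeff m) hwf
  rw [coeff_homogeneousComponent, coeff_homogeneousComponent, if_pos hmd, if_pos hmd] at this
  rw [coeff_sub, this, sub_self]

/-- Leading forms of an ideal are stable under multiplication by indeterminates, and every term of
degree `i + 1` is an indeterminate times a term of degree `i`. -/
lemma topForms_ideal_eq_of_le {I : Ideal (MvPolynomial (Fin n) K)} {d i : ℕ} (hdi : d ≤ i)
    (h : topForms (I.restrictScalars K) d = restrictSupport K (termsEq n d : Set (Fin n →₀ ℕ))) :
    topForms (I.restrictScalars K) i = restrictSupport K (termsEq n i : Set (Fin n →₀ ℕ)) := by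
  induction i, hdi using Nat.le_induction with
  | base => exact h
  | succ i _ ih =>
    refine le_antisymm (topForms_le _ _) ?_
    rw [restrictSupport_eq_span, Submodule.span_le]
    rintro _ ⟨m, hm, rfl⟩
    rw [Finset.mem_coe, mem_termsEq] at hm
    have hm0 : m ≠ 0 := fun h => by simp [h] at hm
    obtain ⟨j, hj⟩ := Finsupp.ne_iff.1 hm0
    obtain ⟨m', rfl⟩ : ∃ m', m = Finsupp.single j 1 + m' :=
      exists_add_of_le (Finsupp.single_le_iff.2 (Nat.one_le_iff_ne_zero.2 hj))
    have hk' : m'.degree = i := by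
      rw [map_add, Finsupp.degree_single] at hm
      omega
    have : monomial m' (1 : K) ∈ topForms (I.restrictScalars K) i := by
      rw [ih]
      exact (monomial_mem_restrictSupport K).2 (Or.inl (by simpa using hk'))
    obtain ⟨f, hf, hfi, hfm⟩ := mem_topForms.1 this
    refine mem_topForms.2 ⟨X j * f, I.mul_mem_left _ hf,
      X_mul_mem_restrictSupport_degree_le
        (restrictSupport_mono K (fun m (hm : m.degree ≤ i) => Nat.lt_succ_of_le hm) hfi) j, ?_⟩
    beta_reduce
    rw [monomial_single_add, pow_one, ← hfm, homogeneousComponent_X_mul]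

/-- For a set in canonical form, leading forms of linear combinations are linear combinations of
leading forms. -/
lemma topForms_span_eq_leadingFormSpan {M : Finset (MvPolynomial (Fin n) K)}
    (hcan : IsCanonicalForm M) (i : ℕ) :
    topForms (Submodule.span K (M : Set (MvPolynomial (Fin n) K))) i = leadingFormSpan M i := by
  obtain ⟨lt, hlt⟩ := hcan
  have hdeg : ∀ p ∈ M, (lt p).degree = p.totalDegree := fun p hp => by
    obtain ⟨h1, h2, -⟩ := hlt p hp
    refine le_antisymm (le_totalDegree h1) ?_
    exact Finset.sup_le fun m hm => h2 m hm
  apply le_antisymm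
  · intro q hq
    obtain ⟨f, hf, hfi, rfl⟩ := mem_topForms.1 hq
    obtain ⟨c, -, rfl⟩ := Submodule.mem_span_finset.1 hf
    -- The term `lt p` occurs in no other element of `M`, so it survives in the sum and the degree
    -- of `f` bounds that of `p`.
    have hc : ∀ p ∈ M, c p ≠ 0 → p.totalDegree ≤ i := by
      intro p hp hcp
      rw [← hdeg p hp]
      refine mem_restrictSupport_iff_coeff.1 hfi _ ?_
      rw [coeff_sum, Finset.sum_eq_single_of_mem p hp]
      · rw [coeff_smul]
        exact mul_ne_zero hcp (mem_support_iff.1 (hlt p hp).1)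
      · intro r hr hrp
        rw [coeff_smul, notMem_support_iff.1 ((hlt p hp).2.2 r hr hrp), smul_zero]
    rw [map_sum]
    refine sum_mem fun p hp => ?_
    rw [map_smul]
    by_cases hcp : c p = 0
    · simp [hcp]
    refine Submodule.smul_mem _ _ ?_
    rcases (hc p hp hcp).lt_or_eq with h | h
    · rw [homogeneousComponent_eq_zero _ _ h]
      exact zero_mem _
    · refine Submodule.subset_span ⟨p, ?_, by rw [leadingForm, h]⟩
      simp [degPart, hp, h]
  · rw [leadingFormSpan, Submodule.span_le]
    rintro _ ⟨p, hp, rfl⟩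
    simp only [degPart, Finset.coe_filter, Set.mem_ofPred_eq] at hp
    refine mem_topForms.2 ⟨p, Submodule.subset_span hp.1, fun m hm => ?_, ?_⟩
    · exact (le_totalDegree hm).trans hp.2.le
    · rw [leadingForm, hp.2]

/-! ### Comparison of the two polytopes -/

lemma leadingFormSpan_le (M : Finset (MvPolynomial (Fin n) K)) (i : ℕ) :
    leadingFormSpan M i ≤ restrictSupport K (termsEq n i : Set (Fin n →₀ ℕ)) := by
  rw [leadingFormSpan, Submodule.span_le]
  rintro _ ⟨p, hp, rfl⟩
  simp only [degPart, Finset.coe_filter, Set.mem_ofPred_eq] at hp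
  rw [leadingForm, hp.2]
  exact homogeneousComponent_mem_restrictSupport i p

lemma map_subtype_universeEq {d i : ℕ} (hi : i ≤ d) :
    (universeEq n d i).map (Function.Embedding.subtype _) = termsEq n i := by
  ext m
  simp only [universeEq, Finset.mem_map, Finset.mem_filter, Finset.mem_univ, true_and,
    Function.Embedding.subtype_apply, mem_termsEq]
  constructor
  · rintro ⟨a, ha, rfl⟩
    exact ha
  · exact fun h => ⟨⟨m, mem_termsLE.2 (h.trans_le hi)⟩, h, rfl⟩

/-- In degrees below `d`, the inequalities of the two polytopes are exchanged by passing to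
complementary sets of terms. -/
lemma forall_sum_le_iff_forall_sum_ge (M : Finset (MvPolynomial (Fin n) K)) {d i : ℕ} (hi : i < d)
    {y : (Fin n →₀ ℕ) → ℝ}
    (hy : ∑ m ∈ termsEq n i, y m =
      ((termsEq n i).card : ℝ) - Module.finrank K (leadingFormSpan M i)) :
    (∀ S : Finset (Fin n →₀ ℕ), S ⊆ termsEq n i →
      (S.card : ℤ) = (termsEq n i).card - Module.finrank K (leadingFormSpan M i) →
      ∑ m ∈ S, y m ≤
        (Module.finrank K ↥(restrictSupport K (S : Set (Fin n →₀ ℕ)) ⊔ leadingFormSpan M i) : ℝ) -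
          Module.finrank K (leadingFormSpan M i)) ↔
    (∀ U : Finset (termsLE n d), U ⊆ universeEq n d i →
      U.card = Module.finrank K (leadingFormSpan M i) →
      ∑ m ∈ U, y m ≥ (U.card : ℝ) - (leadingFormMatrix M i U).rank) := by
  have hmem : ∀ u : termsLE n d, u ∈ universeEq n d i ↔ (u : Fin n →₀ ℕ).degree = i := by
    simp [universeEq]
  -- With `N` terms of degree `i` and `r` the dimension of the leading forms, the sums over `S` and
  -- `U` add up to `N - r`. Hence a sum over `S` of at most `|S| + rk - r` means a sum over `U` of
  -- at least `N - |S| - rk = |U| - rk`. The size conditions `|S| = N - r` and `|U| = r` correspond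
  -- as well.
  have key : ∀ (S : Finset (Fin n →₀ ℕ)) (U : Finset (termsLE n d)), U ⊆ universeEq n d i →
      S = termsEq n i \ U.map (Function.Embedding.subtype _) →
      U.card + S.card = (termsEq n i).card ∧ ∑ m ∈ S, y m + ∑ m ∈ U, y m = ∑ m ∈ termsEq n i, y m ∧
      Module.finrank K ↥(restrictSupport K (S : Set (Fin n →₀ ℕ)) ⊔ leadingFormSpan M i) =
        S.card + (leadingFormMatrix M i U).rank := by
    intro S U hU hSU
    have hsub : U.map (Function.Embedding.subtype _) ⊆ termsEq n i :=
      map_subtype_universeEq (n := n) hi.le ▸ Finset.map_subset_map.2 hU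
    refine ⟨?_, ?_, rank_leadingFormMatrix_add_finrank_sup M i U (T := termsEq n i) ?_
      (leadingFormSpan_le M i)⟩
    · have := Finset.card_sdiff_add_card_eq_card hsub
      rw [Finset.card_map, ← hSU] at this
      omega
    · have := Finset.sum_sdiff (f := y) hsub
      rwa [Finset.sum_map, ← hSU] at this
    · intro m
      simp only [hSU, Finset.mem_sdiff, Finset.mem_map, Function.Embedding.subtype_apply, not_exists,
        not_and]
  constructor
  · intro h U hU hUc
    obtain ⟨h1, h2, h3⟩ := key _ U hU rfl
    have h4 := h (termsEq n i \ U.map (Function.Embedding.subtype _)) Finset.sdiff_subset (by omega)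
    rw [h3] at h4
    rify at h1 hUc
    push_cast at h4
    rw [hy] at h2
    linarith
  · intro h S hS hSc
    obtain ⟨U, hUdef⟩ : ∃ U : Finset (termsLE n d),
        U = (universeEq n d i).filter fun u : termsLE n d => (u : Fin n →₀ ℕ) ∉ S := ⟨_, rfl⟩
    have hU : U ⊆ universeEq n d i := hUdef ▸ Finset.filter_subset _ _
    have hSU : S = termsEq n i \ U.map (Function.Embedding.subtype _) := by
      ext m
      simp only [Finset.mem_sdiff, mem_termsEq, Finset.mem_map, hUdef, Finset.mem_filter, hmem,
        Function.Embedding.subtype_apply, not_exists, not_and]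
      constructor
      · rintro hm
        refine ⟨mem_termsEq.1 (hS hm), ?_⟩
        rintro u ⟨-, hu⟩ rfl
        exact hu hm
      · rintro ⟨hm, h⟩
        by_contra hmS
        exact h ⟨m, mem_termsLE.2 (hm.trans_le hi.le)⟩ ⟨hm, hmS⟩ rfl
    obtain ⟨h1, h2, h3⟩ := key S U hU hSU
    have h4 := h U hU (by omega)
    rw [h3]
    have h5 : U.card = Module.finrank K (leadingFormSpan M i) := by omega
    rify at h1 h5
    push_cast
    rw [hy] at h2
    linarith

/-- For the ideal generated by a stabilized set in canonical form, the spaces of leading forms are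
spanned by the leading forms of the generators in degrees below `d`, and are everything from
degree `d` on. -/
lemma topForms_ideal_span {d : ℕ} {M : Finset (MvPolynomial (Fin n) K)}
    (hstab : IsStabilized (termsLE n d) M) (hcan : IsCanonicalForm M)
    (htop : topForms (Submodule.span K (M : Set (MvPolynomial (Fin n) K))) d =
      restrictSupport K (termsEq n d : Set (Fin n →₀ ℕ))) :
    (∀ i ≤ d, topForms ((Ideal.span (M : Set (MvPolynomial (Fin n) K))).restrictScalars K) i =
      leadingFormSpan M i) ∧
    ∀ i, d ≤ i → topForms ((Ideal.span (M : Set (MvPolynomial (Fin n) K))).restrictScalars K) i =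
      restrictSupport K (termsEq n i : Set (Fin n →₀ ℕ)) := by
  set W := Submodule.span K (M : Set (MvPolynomial (Fin n) K)) with hW
  have hWI : W ≤ (Ideal.span (M : Set (MvPolynomial (Fin n) K))).restrictScalars K :=
    Submodule.span_le.2 fun p hp => Ideal.subset_span hp
  have hL : (termsLE n d : Set (Fin n →₀ ℕ)) = {m | m.degree ≤ d} := by
    ext m
    simp
  refine ⟨fun i hi => ?_, fun i hi => topForms_ideal_eq_of_le hi
    (le_antisymm (topForms_le _ _) (htop ▸ topForms_mono hWI d))⟩
  rw [← topForms_span_eq_leadingFormSpan hcan]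
  refine le_antisymm ?_ (topForms_mono hWI i)
  intro p hp
  obtain ⟨f, hf, hfi, rfl⟩ := mem_topForms.1 hp
  refine mem_topForms.2 ⟨f, ?_, hfi, rfl⟩
  refine mem_of_mem_ideal_span_of_stabilized
    (W' := Submodule.span K (neighborhoodExt (M : Set (MvPolynomial (Fin n) K))))
    ?_ (hL ▸ hstab.2) (fun g hg => exists_sub_mem_of_topForms_eq htop hg)
    (Ideal.span_mono Submodule.subset_span hf)
    (restrictSupport_mono K (fun m (hm : m.degree ≤ i) => hm.trans hi) hfi)
  -- Multiplication by `X j` is linear, so it is enough to treat generators, whose multiples lie in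
  -- `M⁺` by definition.
  intro w hw j
  induction hw using Submodule.span_induction with
  | mem p hp =>
    refine Submodule.subset_span (Or.inr (Set.mem_iUnion.2 ⟨j, p, hp, ?_⟩))
    exact mul_comm _ _
  | zero => simp
  | add p q _ _ hp hq => rw [mul_add]; exact add_mem hp hq
  | smul c p _ hp => rw [mul_smul_comm]; exact Submodule.smul_mem _ _ hp

lemma extendByZero_coe {L : Finset (Fin n →₀ ℕ)} (z : L → ℝ) (m : L) :
    extendByZero z m = z m := by
  simp [extendByZero]

lemma extendByZero_of_notMem {L : Finset (Fin n →₀ ℕ)} (z : L → ℝ) {m : Fin n →₀ ℕ} (hm : m ∉ L) :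
    extendByZero z m = 0 := by
  simp [extendByZero, hm]

/-- A vector of the order ideal polytope vanishes on the terms of a degree in which every form is
a leading form. -/
lemma apply_eq_zero_of_mem_orderIdealPolytope {I : Ideal (MvPolynomial (Fin n) K)}
    {y : (Fin n →₀ ℕ) → ℝ} (hy : y ∈ orderIdealPolytope I) {m : Fin n →₀ ℕ}
    (h : topForms (I.restrictScalars K) m.degree =
      restrictSupport K (termsEq n m.degree : Set (Fin n →₀ ℕ))) : y m = 0 := by
  have hs := hy.2.1 m.degree
  rw [finrank_gradedPiece, h, sub_self] at hs
  exact (Finset.sum_eq_zero_iff_of_nonneg fun a _ => (hy.2.2.2 a).1).1 hs m (mem_termsEq.2 rfl)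

/-- Below degree `d` the constraints correspond by complementation. From degree `d` on, the
prescribed sums are `0`, which with nonnegativity forces vanishing; conversely, the zero vector
meets every constraint there. -/
lemma extendByZero_mem_orderIdealPolytope_iff {I : Ideal (MvPolynomial (Fin n) K)} {d : ℕ}
    {M : Finset (MvPolynomial (Fin n) K)}
    (hlt : ∀ i < d, topForms (I.restrictScalars K) i = leadingFormSpan M i)
    (hge : ∀ i, d ≤ i → topForms (I.restrictScalars K) i =
      restrictSupport K (termsEq n i : Set (Fin n →₀ ℕ)))
    (z : termsLE n d → ℝ) :
    extendByZero z ∈ orderIdealPolytope I ↔ z ∈ explicitPolytope d M := by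
  have hsum : ∀ i ≤ d, ∑ m ∈ universeEq n d i, z m = ∑ m ∈ termsEq n i, extendByZero z m := by
    intro i hi
    rw [← map_subtype_universeEq hi, Finset.sum_map]
    exact Finset.sum_congr rfl fun m _ => (extendByZero_coe z m).symm
  have hmem : ∀ i, ∀ u : termsLE n d, u ∈ universeEq n d i ↔ (u : Fin n →₀ ℕ).degree = i := by
    simp [universeEq]
  constructor
  · intro hy
    have hz := fun (m : Fin n →₀ ℕ) (hm : d ≤ m.degree) =>
      apply_eq_zero_of_mem_orderIdealPolytope hy (hge _ hm)
    obtain ⟨h1, h2, h3, h4⟩ := hy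
    refine ⟨fun m₁ m₂ h => ?_, fun i hi => ?_, fun i hi => ?_, fun m hm => ?_, fun m => ?_⟩
    · simpa only [extendByZero_coe] using h1 m₁ m₂ h
    · rw [hsum i hi.le, h2, finrank_gradedPiece, hlt i hi]
    · have h2' := h2 i
      have h3' := h3 i
      rw [finrank_gradedPiece, hlt i hi, finrank_restrictSupport] at h2'
      rw [finrank_gradedPiece, hlt i hi, finrank_restrictSupport] at h3'
      simpa only [extendByZero_coe] using (forall_sum_le_iff_forall_sum_ge M hi h2').1 h3'
    · rw [← extendByZero_coe z m]
      exact hz m ((hmem d m).1 hm).ge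
    · rw [← extendByZero_coe z m]
      exact h4 m
  · rintro ⟨h1, h2, h3, h4, h5⟩
    have hIcc : ∀ m, extendByZero z m ∈ Set.Icc (0 : ℝ) 1 := by
      intro m
      by_cases hm : m ∈ termsLE n d
      · exact (extendByZero_coe z ⟨m, hm⟩).symm ▸ h5 ⟨m, hm⟩
      · simp [extendByZero_of_notMem z hm]
    have hz : ∀ m : Fin n →₀ ℕ, d ≤ m.degree → extendByZero z m = 0 := by
      intro m hm
      by_cases hmL : m ∈ termsLE n d
      · exact (extendByZero_coe z ⟨m, hmL⟩).trans
          (h4 _ ((hmem d _).2 (le_antisymm (mem_termsLE.1 hmL) hm)))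
      · exact extendByZero_of_notMem z hmL
    refine ⟨fun m₁ m₂ h => ?_, fun i => ?_, fun i => ?_, hIcc⟩
    · by_cases hm : m₂ ∈ termsLE n d
      · have hm₁ : m₁ ∈ termsLE n d :=
          mem_termsLE.2 ((Finsupp.degree_mono h).trans (mem_termsLE.1 hm))
        have := h1 ⟨m₁, hm₁⟩ ⟨m₂, hm⟩ h
        rwa [← extendByZero_coe z, ← extendByZero_coe z] at this
      · rw [extendByZero_of_notMem z hm]
        exact (hIcc m₁).1
    · rw [finrank_gradedPiece]
      rcases lt_or_ge i d with hi | hi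
      · rw [hlt i hi, ← hsum i hi.le, h2 i hi]
      · rw [hge i hi, sub_self]
        exact Finset.sum_eq_zero fun m hm => hz m (hi.trans (mem_termsEq.1 hm).ge)
    · rw [finrank_gradedPiece]
      rcases lt_or_ge i d with hi | hi
      · have h2' := h2 i hi
        have h3' := h3 i hi
        rw [hsum i hi.le, finrank_restrictSupport] at h2'
        simp only [← extendByZero_coe z] at h3'
        rw [hlt i hi, finrank_restrictSupport]
        exact (forall_sum_le_iff_forall_sum_ge M hi h2').2 h3'
      · intro U hU _
        -- The leading forms already contain the span of `U`, so the bound is `0`.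
        rw [hge i hi, sup_eq_right.2 (restrictSupport_mono K (Finset.coe_subset.2 hU)), sub_self]
        exact (Finset.sum_eq_zero fun m hm => hz m (hi.trans (mem_termsEq.1 (hU hm)).ge)).le

end OrderIdealPolytope

theorem mainTheorem3 {K : Type*} [Field K] (n d : ℕ)
    (M : Finset (MvPolynomial (Fin n) K))
    (hzero : FiniteDimensional K
      (MvPolynomial (Fin n) K ⧸ Ideal.span (M : Set (MvPolynomial (Fin n) K))))
    (hstab : OrderIdealPolytope.IsStabilized (OrderIdealPolytope.termsLE n d) M)
    (hcan : OrderIdealPolytope.IsCanonicalForm M)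
    (htop : Nonempty
      (OrderIdealPolytope.GradedPiece
          (Submodule.span K (M : Set (MvPolynomial (Fin n) K))) d ≃ₗ[K]
        MvPolynomial.restrictSupport K
          (OrderIdealPolytope.termsEq n d : Set (Fin n →₀ ℕ)))) :
    OrderIdealPolytope.orderIdealPolytope
        (Ideal.span (M : Set (MvPolynomial (Fin n) K))) =
      OrderIdealPolytope.extendByZero '' OrderIdealPolytope.explicitPolytope d M := by
  obtain ⟨hle, hge⟩ := OrderIdealPolytope.topForms_ideal_span hstab hcan
    (OrderIdealPolytope.topForms_eq_of_gradedPiece_equiv htop)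
  have hiff := OrderIdealPolytope.extendByZero_mem_orderIdealPolytope_iff
    (fun i hi => hle i hi.le) hge
  ext y
  constructor
  · intro hy
    -- Terms outside `L` have degree above `d`, where `y` vanishes, so `y` is recovered from its
    -- restriction to `L`.
    have hyz : OrderIdealPolytope.extendByZero
        (fun m : OrderIdealPolytope.termsLE n d => y m) = y := by
      funext m
      by_cases hm : m ∈ OrderIdealPolytope.termsLE n d
      · exact OrderIdealPolytope.extendByZero_coe _ ⟨m, hm⟩
      · rw [OrderIdealPolytope.extendByZero_of_notMem _ hm]
        refine (OrderIdealPolytope.apply_eq_zero_of_mem_orderIdealPolytope hy (hge _ ?_)).symm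
        exact (not_le.1 fun h => hm (OrderIdealPolytope.mem_termsLE.2 h)).le
    exact ⟨_, (hiff _).1 (hyz.symm ▸ hy), hyz⟩
  · rintro ⟨z, hz, rfl⟩
    exact (hiff z).2 hz
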